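/- Let $\alpha,\beta\in(1,2)$ and $d,e>0$. For $\gamma\in(1,2)$ put $f_\gamma(\xi)=-\frac{2-\gamma(1-e^{-\mathrm i\xi})}{2}\,\bigl(1+e^{\mathrm i(\xi+\pi)}\bigr)^{\gamma}$ (principal branch) and $q_\gamma(\xi)=f_\gamma(\xi)+f_\gamma(-\xi)$. Consider a sequence of discretizations with odd numbers of grid points $n_1,n_2$ and positive step sizes $h_x,h_y,\Delta t$ (all depending on the element of the sequence), set $N=n_1n_2$, $r=\frac{\Delta t}{2h_x^{\alpha}}$, $s=\frac{\Delta t}{2h_y^{\beta}}$, and assume that along the sequence $\frac1r=\frac{2h_x^\alpha}{\Delta t}=o(1)$ and that $\frac sr=\frac{h_x^\alpha}{h_y^\beta}$ is of order one, i.e. it is eventually bounded and bounded away from zero (in particular, $\frac sr$ may be a fixed positive constant). Let $$\mathcal F_{(\alpha,\beta)}(\theta_1,\theta_2)=d\,q_\alpha(\theta_1)+e\,\tfrac sr\,q_\beta(\theta_2),\qquad p(\theta_1,\theta_2)=(1+\cos\theta_1)(1+\cos\theta_2).$$ For an integrable function $g$ on $[-\pi,\pi]^2$ let $T_N^{(2)}(g)$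 be the $N\times N$ two-level Toeplitz matrix whose entry in row $(i_1,i_2)$ and column $(j_1,j_2)$ ($1\le i_\ell,j_\ell\le n_\ell$) is the Fourier coefficient $g_{(i_1-j_1,\,i_2-j_2)}$, where $g_{\mathbf k}=\frac1{(2\pi)^2}\int_{[-\pi,\pi]^2}g(\boldsymbol\theta)e^{-\mathrm i\langle\mathbf k,\boldsymbol\theta\rangle}d\boldsymbol\theta$. Let $k_\ell=(n_\ell-(n_\ell\bmod 2))/2$ (so $n_\ell=2k_\ell+1$), let $K_{n}^{k}\in\mathbb R^{n\times k}$ be the down-sampling matrix with entries $1$ if $i=2j-((n+1)\bmod 2)$ and $0$ otherwise, and put $k=k_1k_2$, $$A_N=T_N^{(2)}(\mathcal F_{(\alpha,\beta)}),\qquad D_N=\operatorname{diag}(A_N),\qquad P_N=T_N^{(2)}(p)\,\bigl(K_{n_1}^{k_1}\otimes K_{n_2}^{k_2}\bigr)\in\mathbb C^{N\times k}.$$ Then every $A_N$ is Hermitian positive definite, and there is $\xi>0$, independent of the element of the sequence (in particular of $N$), such that for every $\mathbf x\in\mathbb C^N$ $$\min_{\mathbf y\in\mathbb C^k}\|\mathbf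 x-P_N\mathbf y\|_{D_N}^2\le\xi\,\|\mathbf x\|_{A_N}^2,$$ where $\|\mathbf v\|_X=\|X^{1/2}\mathbf v\|_2$ for a positive definite matrix $X$. -/

import Mathlib

open Filter Asymptotics
open scoped Topology Kronecker ComplexOrder

noncomputable section

/-- Fourier coefficient `f_{(k₁,k₂)}` of a function `f` on `[-π,π]²`. -/
def fourierCoeff₂ (f : ℝ × ℝ → ℂ) (k₁ k₂ : ℤ) : ℂ :=
  1 / (2 * (Real.pi : ℂ)) ^ 2 *
    ∫ θ in Set.Icc (-Real.pi) Real.pi ×ˢ Set.Icc (-Real.pi) Real.pi,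
      f θ * Complex.exp (-Complex.I * ((k₁ : ℂ) * (θ.1 : ℂ) + (k₂ : ℂ) * (θ.2 : ℂ)))

/-- The 2-level Toeplitz matrix `T_N^{(2)}(f)`, `N = n₁ n₂`, with symbol `f`: the entry in
row `(i₁,i₂)` and column `(j₁,j₂)` is the Fourier coefficient `f_{(i₁-j₁, i₂-j₂)}`. -/
def toeplitz₂ (n₁ n₂ : ℕ) (f : ℝ × ℝ → ℂ) : Matrix (Fin n₁ × Fin n₂) (Fin n₁ × Fin n₂) ℂ :=
  fun i j => fourierCoeff₂ f ((i.1 : ℤ) - (j.1 : ℤ)) ((i.2 : ℤ) - (j.2 : ℤ))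

/-- The symbol of the (unscaled) WSGD discretization of a fractional derivative of order `γ`:
`f_γ(ξ) = -[(2 - γ(1 - e^{-iξ}))/2] (1 + e^{i(ξ+π)})^γ` (principal branch). -/
def wsgdSymbol (γ : ℝ) (ξ : ℝ) : ℂ :=
  -((2 - (γ : ℂ) * (1 - Complex.exp (-Complex.I * (ξ : ℂ)))) / 2) *
    (1 + Complex.exp (Complex.I * ((ξ : ℂ) + (Real.pi : ℂ)))) ^ (γ : ℂ)

/-- `q_γ(ξ) = f_γ(ξ) + f_γ(-ξ)`. -/
def qSymbol (γ : ℝ) (ξ : ℝ) : ℂ := wsgdSymbol γ ξ + wsgdSymbol γ (-ξ)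

/-- `𝓕_{(α,β)}(θ₁,θ₂) = d q_α(θ₁) + e (s/r) q_β(θ₂)`. -/
def Fsymbol (α β d e r s : ℝ) (θ : ℝ × ℝ) : ℂ :=
  (d : ℂ) * qSymbol α θ.1 + (e : ℂ) * ((s / r : ℝ) : ℂ) * qSymbol β θ.2

/-- The symbol `p(θ₁,θ₂) = (1 + cos θ₁)(1 + cos θ₂)` of the grid transfer operator. -/
def pSymbol (θ : ℝ × ℝ) : ℂ :=
  (((1 + Real.cos θ.1) * (1 + Real.cos θ.2) : ℝ) : ℂ)

/-- Number of coarse points `k = (n - (n mod 2)) / 2` in one dimension. -/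
def coarseSize (n : ℕ) : ℕ := (n - n % 2) / 2

/-- One-dimensional down-sampling matrix `K_n^k`. With the one-based indices `i + 1` and
`j + 1`, the entry is `1` iff `i + 1 = 2 (j + 1) - ((n + 1) mod 2)`. -/
def downSample (n : ℕ) : Matrix (Fin n) (Fin (coarseSize n)) ℂ :=
  fun i j => if (i : ℕ) + 1 = 2 * ((j : ℕ) + 1) - (n + 1) % 2 then 1 else 0

/-- The projector `P_N = T_N^{(2)}(p) (K_{n₁}^{k₁} ⊗ K_{n₂}^{k₂})`. -/
def projector (n₁ n₂ : ℕ) :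
    Matrix (Fin n₁ × Fin n₂) (Fin (coarseSize n₁) × Fin (coarseSize n₂)) ℂ :=
  toeplitz₂ n₁ n₂ pSymbol * (downSample n₁ ⊗ₖ downSample n₂)

/-- Squared energy norm `‖x‖²_X = ‖X^{1/2} x‖₂² = x^* X x` of a positive definite matrix. -/
def energySq {ι : Type*} [Fintype ι] (X : Matrix ι ι ℂ) (x : ι → ℂ) : ℝ :=
  (star x ⬝ᵥ X.mulVec x).re

/-- The mesh parameter `Δt / (2 h^γ)`; it is `r` for `(h_x, α)` and `s` for `(h_y, β)`. -/
def meshParam (Δt h γ : ℝ) : ℝ := Δt / (2 * h ^ γ)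

end

/-! Everything is compared with the discrete Laplacian `L = T(1 - cos) ⊗ I + I ⊗ T(1 - cos)`. On the
box each `q_γ` dominates a positive multiple of `1 - cos` (`qLowerConst_mul_le`). Toeplitz quadratic
forms are monotone in the symbol, so `A_N ≥ c L` with `c` depending only on `α, β, d, e` and a lower
bound of `s / r`. This also gives positive definiteness. The diagonal of `A_N` is constant, equal to
the mean of the symbol, hence at most some `M` controlled by an upper bound of `s / r`. The claim
thus reduces to a Euclidean approximation estimate `‖x - P y‖² ≤ 40 ⟨Lx, x⟩` for one well-chosen
`y`. Take `y` to be the samples of `x` at the coarse points. Then `P y` is the bilinear interpolant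
of these samples, and in one dimension the interpolation error is `T(1 - cos) v` restricted to the
dropped points (`tridiag_mul_diagonal`), whose norm the Dirichlet energy bounds. A tensor splitting
carries this to two dimensions (`sumSq_interpolation_le`), so `ξ = 40 M / c` works. -/

/-! ### The one-dimensional symbol: continuity, reality, lower bound. -/

lemma one_add_exp_re_nonneg (t : ℝ) :
    0 ≤ (1 + Complex.exp (Complex.I * ((t : ℂ) + (Real.pi : ℂ)))).re := by
  have h : Complex.I * ((t : ℂ) + (Real.pi : ℂ)) = ((t + Real.pi : ℝ) : ℂ) * Complex.I := by
    push_cast; ring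
  rw [h, Complex.add_re, Complex.exp_ofReal_mul_I_re, Complex.one_re]
  linarith [Real.neg_one_le_cos (t + Real.pi)]

/-- The base of the power stays in the closed right half-plane, away from the branch cut except at
its zero, where a positive exponent still gives continuity. -/
lemma wsgdSymbol_continuous {γ : ℝ} (hγ : 0 < γ) : Continuous (wsgdSymbol γ) := by
  unfold wsgdSymbol
  refine Continuous.mul (by fun_prop) ?_
  rw [continuous_iff_continuousAt]
  intro t
  exact ContinuousAt.comp
    (g := fun z : ℂ => z ^ (γ : ℂ))
    (f := fun t : ℝ => 1 + Complex.exp (Complex.I * ((t : ℂ) + (Real.pi : ℂ))))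
    (Complex.continuousAt_cpow_const_of_re_pos (Or.inl (one_add_exp_re_nonneg t)) (by simpa))
    (by fun_prop)

lemma qSymbol_continuous {γ : ℝ} (hγ : 0 < γ) : Continuous (qSymbol γ) := by
  unfold qSymbol
  exact (wsgdSymbol_continuous hγ).add ((wsgdSymbol_continuous hγ).comp continuous_neg)

lemma wsgdSymbol_neg (γ t : ℝ) : wsgdSymbol γ (-t) = starRingEnd ℂ (wsgdSymbol γ t) := by
  have harg : (1 + Complex.exp (Complex.I * ((t : ℂ) + (Real.pi : ℂ)))).arg ≠ Real.pi := by
    have := one_add_exp_re_nonneg t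
    intro h
    rw [Complex.arg_eq_pi_iff] at h
    linarith [h.1]
  have hexp : Complex.exp (Complex.I * (((-t : ℝ) : ℂ) + (Real.pi : ℂ))) =
      starRingEnd ℂ (Complex.exp (Complex.I * ((t : ℂ) + (Real.pi : ℂ)))) := by
    rw [← Complex.exp_conj]
    have : Complex.I * (((-t : ℝ) : ℂ) + (Real.pi : ℂ)) =
      starRingEnd ℂ (Complex.I * ((t : ℂ) + (Real.pi : ℂ))) + 2 * Real.pi * Complex.I := by
      simp only [map_mul, map_add, Complex.conj_I, Complex.conj_ofReal]
      push_cast; ring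
    rw [this, Complex.exp_add, Complex.exp_two_pi_mul_I, mul_one]
  have hpow := Complex.conj_cpow _ (γ : ℂ) harg
  rw [Complex.conj_ofReal, map_add, map_one] at hpow
  unfold wsgdSymbol
  rw [hexp, map_mul, hpow]
  have h2 : starRingEnd ℂ 2 = 2 := Complex.conj_ofNat 2
  simp [← Complex.exp_conj, h2]

lemma qSymbol_eq_ofReal (γ t : ℝ) : qSymbol γ t = ((2 * (wsgdSymbol γ t).re : ℝ) : ℂ) := by
  rw [qSymbol, wsgdSymbol_neg, Complex.add_conj]

lemma qSymbol_neg (γ t : ℝ) : qSymbol γ (-t) = qSymbol γ t := by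
  rw [qSymbol, qSymbol, neg_neg, add_comm]

/-- With `ξ = π - 2u` the base is `1 + e^{-2iu} = 2 cos u · e^{-iu}`. This polar form has its
argument in the principal range, so the power is explicit. -/
lemma wsgdSymbol_re_eq {γ u : ℝ} (hu : 0 ≤ u) (hu' : u < Real.pi / 2) :
    (wsgdSymbol γ (Real.pi - 2 * u)).re =
      1 / 2 * (2 * Real.cos u) ^ γ *
        (γ * Real.cos ((2 - γ) * u) - (2 - γ) * Real.cos (γ * u)) := by
  have hcos : 0 < Real.cos u := Real.cos_pos_of_mem_Ioo ⟨by linarith [Real.pi_pos], hu'⟩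
  have hbase : 1 + Complex.exp (Complex.I * (((Real.pi - 2 * u : ℝ) : ℂ) + (Real.pi : ℂ))) =
      ((2 * Real.cos u : ℝ) : ℂ) * Complex.exp ((-u : ℝ) * Complex.I) := by
    have h1 : Complex.I * (((Real.pi - 2 * u : ℝ) : ℂ) + (Real.pi : ℂ)) =
        (-u : ℝ) * Complex.I + (-u : ℝ) * Complex.I + 2 * Real.pi * Complex.I := by
      push_cast; ring
    have h2 : ((2 * Real.cos u : ℝ) : ℂ) =
        Complex.exp (u * Complex.I) + Complex.exp (-u * Complex.I) := by
      push_cast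
      rw [Complex.two_cos]
    rw [h1, Complex.exp_add, Complex.exp_two_pi_mul_I, mul_one, h2, add_mul,
      Complex.exp_add, ← Complex.exp_add (u * Complex.I)]
    simp
  have hlog : Complex.log (((2 * Real.cos u : ℝ) : ℂ) * Complex.exp ((-u : ℝ) * Complex.I)) =
      (Real.log (2 * Real.cos u) : ℂ) + (-u : ℝ) * Complex.I := by
    rw [Complex.log_ofReal_mul (by positivity) (Complex.exp_ne_zero _), Complex.log_exp]
    · simp; linarith [Real.pi_pos]
    · simp; linarith [Real.pi_pos]
  have hpow : (((2 * Real.cos u : ℝ) : ℂ) * Complex.exp ((-u : ℝ) * Complex.I)) ^ (γ : ℂ) =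
      (((2 * Real.cos u) ^ γ : ℝ) : ℂ) * Complex.exp ((-(γ * u) : ℝ) * Complex.I) := by
    rw [Complex.cpow_def_of_ne_zero
      (mul_ne_zero (by exact_mod_cast (by positivity : (2 * Real.cos u) ≠ 0))
        (Complex.exp_ne_zero _)), hlog, add_mul, Complex.exp_add,
      Real.rpow_def_of_pos (by positivity)]
    push_cast
    ring_nf
  have hexp : Complex.exp (-Complex.I * ((Real.pi - 2 * u : ℝ) : ℂ)) =
      - Complex.exp ((2 * u : ℝ) * Complex.I) := by
    have : -Complex.I * ((Real.pi - 2 * u : ℝ) : ℂ) =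
        (2 * u : ℝ) * Complex.I - Real.pi * Complex.I := by push_cast; ring
    rw [this, Complex.exp_sub, Complex.exp_pi_mul_I, div_neg, div_one]
  have hmul : Complex.exp ((2 * u : ℝ) * Complex.I) * Complex.exp ((-(γ * u) : ℝ) * Complex.I) =
      Complex.exp (((2 - γ) * u : ℝ) * Complex.I) := by
    rw [← Complex.exp_add]; push_cast; ring_nf
  unfold wsgdSymbol
  rw [hbase, hpow, hexp]
  have : -((2 - (γ : ℂ) * (1 - -Complex.exp ((2 * u : ℝ) * Complex.I))) / 2) *
      ((((2 * Real.cos u) ^ γ : ℝ) : ℂ) * Complex.exp ((-(γ * u) : ℝ) * Complex.I)) =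
      ((1 / 2 * (2 * Real.cos u) ^ γ : ℝ) : ℂ) *
        ((γ : ℂ) * Complex.exp (((2 - γ) * u : ℝ) * Complex.I) -
          ((2 - γ : ℝ) : ℂ) * Complex.exp ((-(γ * u) : ℝ) * Complex.I)) := by
    rw [← hmul]; push_cast; ring
  rw [this, Complex.re_ofReal_mul, Complex.sub_re, Complex.re_ofReal_mul, Complex.re_ofReal_mul,
    Complex.exp_ofReal_mul_I_re, Complex.exp_ofReal_mul_I_re, Real.cos_neg]

/-- The constant in the lower bound of `qSymbol γ` by the symbol of the discrete Laplacian. -/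
noncomputable def qLowerConst (γ : ℝ) : ℝ := (γ - 1) * Real.cos ((2 - γ) * (Real.pi / 2))

lemma qLowerConst_pos {γ : ℝ} (hγ : γ ∈ Set.Ioo (1 : ℝ) 2) : 0 < qLowerConst γ := by
  obtain ⟨h1, h2⟩ := hγ
  refine mul_pos (by linarith) (Real.cos_pos_of_mem_Ioo ⟨?_, ?_⟩) <;>
    nlinarith [Real.pi_pos]

lemma qLowerConst_mul_le {γ : ℝ} (hγ : γ ∈ Set.Ioo (1 : ℝ) 2) {t : ℝ}
    (ht : t ∈ Set.Icc (-Real.pi) Real.pi) :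
    qLowerConst γ * (1 - Real.cos t) ≤ (qSymbol γ t).re := by
  have hpos : ∀ t : ℝ, 0 < t → t ≤ Real.pi →
      qLowerConst γ * (1 - Real.cos t) ≤ (qSymbol γ t).re := by
    intro t h0 hpi
    obtain ⟨h1, h2⟩ := hγ
    obtain ⟨u, rfl⟩ : ∃ u, t = Real.pi - 2 * u := ⟨(Real.pi - t) / 2, by ring⟩
    have hu : 0 ≤ u := by linarith
    have hu' : u < Real.pi / 2 := by linarith
    have hc : 0 < Real.cos u := Real.cos_pos_of_mem_Ioo ⟨by linarith [Real.pi_pos], hu'⟩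
    rw [qSymbol_eq_ofReal, Complex.ofReal_re, wsgdSymbol_re_eq hu hu', Real.cos_pi_sub,
      Real.cos_two_mul, qLowerConst]
    have hk0 : 0 ≤ Real.cos ((2 - γ) * (Real.pi / 2)) := by
      refine Real.cos_nonneg_of_mem_Icc ⟨?_, ?_⟩ <;> nlinarith [Real.pi_pos]
    have hk : Real.cos ((2 - γ) * (Real.pi / 2)) ≤ Real.cos ((2 - γ) * u) := by
      refine Real.cos_le_cos_of_nonneg_of_le_pi ?_ ?_ ?_ <;> nlinarith [Real.pi_pos]
    have hk2 : Real.cos (γ * u) ≤ Real.cos ((2 - γ) * u) := by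
      refine Real.cos_le_cos_of_nonneg_of_le_pi ?_ ?_ ?_ <;> nlinarith [Real.pi_pos]
    have hp : Real.cos u ^ 2 ≤ (2 * Real.cos u) ^ γ := by
      have hcγ : Real.cos u ^ (2 : ℝ) ≤ Real.cos u ^ γ :=
        Real.rpow_le_rpow_of_exponent_ge hc (Real.cos_le_one u) h2.le
      have hm : Real.cos u ^ γ ≤ (2 * Real.cos u) ^ γ :=
        Real.rpow_le_rpow hc.le (by linarith) (by linarith)
      rw [Real.rpow_two] at hcγ
      linarith
    -- Replacing `cos (γu)` by the larger `cos ((2 - γ)u)` leaves `(2γ - 2) cos ((2 - γ)u)`, which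
    -- is least at `u = π/2`. Together with `1 - cos t = 2 cos² u` and `hp` this yields the
    -- constant.
    have hb : (γ - 1) * 2 * Real.cos ((2 - γ) * (Real.pi / 2)) ≤
        γ * Real.cos ((2 - γ) * u) - (2 - γ) * Real.cos (γ * u) := by nlinarith
    have hb0 : 0 ≤ (γ - 1) * 2 * Real.cos ((2 - γ) * (Real.pi / 2)) :=
      mul_nonneg (by linarith) hk0
    have := mul_le_mul hp hb hb0 (by positivity)
    nlinarith
  rcases lt_trichotomy t 0 with h | h | h
  · have := hpos (-t) (by linarith) (by linarith [ht.1])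
    rwa [qSymbol_neg, Real.cos_neg] at this
  -- At `t = 0` the base vanishes, so the polar form is unavailable; both sides are zero.
  · subst h
    have hγ0 : (γ : ℂ) ≠ 0 := by exact_mod_cast (by linarith [hγ.1] : γ ≠ 0)
    simp [qSymbol, wsgdSymbol, mul_comm Complex.I, Complex.exp_pi_mul_I, hγ0]
  · exact hpos t h ht.2
-- Two-level Toeplitz matrices and their quadratic forms.
/-- The square `[-π,π]²` over which Fourier coefficients are computed. -/
def torusBox : Set (ℝ × ℝ) := Set.Icc (-Real.pi) Real.pi ×ˢ Set.Icc (-Real.pi) Real.pi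

lemma isCompact_torusBox : IsCompact torusBox := isCompact_Icc.prod isCompact_Icc

/-- The trigonometric polynomial with coefficients `x`. -/
noncomputable def trigPoly {n₁ n₂ : ℕ} (x : Fin n₁ × Fin n₂ → ℂ) (θ : ℝ × ℝ) : ℂ :=
  ∑ j, x j * Complex.exp (Complex.I * (((j.1 : ℕ) : ℂ) * (θ.1 : ℂ) + ((j.2 : ℕ) : ℂ) * (θ.2 : ℂ)))

lemma integrableOn_fourier {g : ℝ × ℝ → ℂ} (hg : Continuous g) (k₁ k₂ : ℤ) :
    MeasureTheory.IntegrableOn (fun θ => g θ *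
      Complex.exp (-Complex.I * ((k₁ : ℂ) * (θ.1 : ℂ) + (k₂ : ℂ) * (θ.2 : ℂ)))) torusBox := by
  apply ContinuousOn.integrableOn_compact isCompact_torusBox
  fun_prop

lemma fourierCoeff₂_eq (g : ℝ × ℝ → ℂ) (k₁ k₂ : ℤ) :
    fourierCoeff₂ g k₁ k₂ = 1 / (2 * (Real.pi : ℂ)) ^ 2 * ∫ θ in torusBox,
      g θ * Complex.exp (-Complex.I * ((k₁ : ℂ) * (θ.1 : ℂ) + (k₂ : ℂ) * (θ.2 : ℂ))) := rfl

lemma toeplitz₂_add {f g : ℝ × ℝ → ℂ} (hf : Continuous f) (hg : Continuous g) (n₁ n₂ : ℕ) :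
    toeplitz₂ n₁ n₂ (fun θ => f θ + g θ) = toeplitz₂ n₁ n₂ f + toeplitz₂ n₁ n₂ g := by
  ext i j
  simp only [toeplitz₂, fourierCoeff₂_eq, Matrix.add_apply, add_mul]
  rw [MeasureTheory.integral_add (integrableOn_fourier hf _ _) (integrableOn_fourier hg _ _),
    mul_add]

lemma toeplitz₂_const_mul (c : ℂ) (f : ℝ × ℝ → ℂ) (n₁ n₂ : ℕ) :
    toeplitz₂ n₁ n₂ (fun θ => c * f θ) = c • toeplitz₂ n₁ n₂ f := by
  ext i j
  simp only [toeplitz₂, fourierCoeff₂_eq, Matrix.smul_apply, mul_assoc,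
    MeasureTheory.integral_const_mul, smul_eq_mul]
  ring

lemma toeplitz₂_isHermitian (g : ℝ × ℝ → ℝ) (n₁ n₂ : ℕ) :
    (toeplitz₂ n₁ n₂ (fun θ => (g θ : ℂ))).IsHermitian := by
  ext i j
  simp only [toeplitz₂, fourierCoeff₂_eq, Matrix.conjTranspose_apply, star_mul', RCLike.star_def]
  rw [← integral_conj]
  congr 1
  · have h2 : starRingEnd ℂ 2 = 2 := Complex.conj_ofNat 2
    simp [h2]
  · congr 1
    ext θ
    rw [map_mul, Complex.conj_ofReal, ← Complex.exp_conj]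
    simp only [map_mul, map_add, map_neg, Complex.conj_I, Complex.conj_ofReal, map_intCast]
    push_cast
    ring_nf

/-- Expanding `|trigPoly x|²` produces exactly the exponentials of index difference `i - j`. All
order relations between symbols pass to matrices through this identity. -/
lemma dotProduct_toeplitz₂ {g : ℝ × ℝ → ℂ} (hg : Continuous g) {n₁ n₂ : ℕ}
    (x : Fin n₁ × Fin n₂ → ℂ) :
    star x ⬝ᵥ (toeplitz₂ n₁ n₂ g).mulVec x =
      1 / (2 * (Real.pi : ℂ)) ^ 2 *
        ∫ θ in torusBox, g θ * (Complex.normSq (trigPoly x θ) : ℂ) := by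
  have hpt : ∀ θ, g θ * (Complex.normSq (trigPoly x θ) : ℂ) = ∑ i, ∑ j,
      (star (x i) * x j) * (g θ * Complex.exp (-Complex.I *
        (((((i.1 : ℕ) : ℤ) - ((j.1 : ℕ) : ℤ) : ℤ) : ℂ) * (θ.1 : ℂ) +
          ((((i.2 : ℕ) : ℤ) - ((j.2 : ℕ) : ℤ) : ℤ) : ℂ) * (θ.2 : ℂ)))) := by
    intro θ
    rw [← Complex.mul_conj, mul_comm (trigPoly x θ), trigPoly, map_sum, Finset.sum_mul_sum,
      Finset.mul_sum]
    refine Finset.sum_congr rfl fun i _ => ?_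
    rw [Finset.mul_sum]
    refine Finset.sum_congr rfl fun j _ => ?_
    rw [map_mul, ← Complex.exp_conj]
    simp only [map_mul, map_add, Complex.conj_I, Complex.conj_ofReal, map_natCast]
    rw [mul_mul_mul_comm, ← Complex.exp_add, RCLike.star_def, mul_left_comm]
    push_cast
    ring_nf
  simp only [hpt]
  rw [MeasureTheory.integral_finsetSum]
  · rw [dotProduct, Finset.mul_sum]
    refine Finset.sum_congr rfl fun i _ => ?_
    rw [MeasureTheory.integral_finsetSum]
    · rw [Matrix.mulVec, dotProduct, Finset.mul_sum, Finset.mul_sum]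
      refine Finset.sum_congr rfl fun j _ => ?_
      rw [MeasureTheory.integral_const_mul, toeplitz₂, fourierCoeff₂_eq, Pi.star_apply]
      ring
    · exact fun j _ => (integrableOn_fourier hg _ _).const_mul _
  · exact fun i _ => MeasureTheory.integrable_finsetSum _ fun j _ =>
      (integrableOn_fourier hg _ _).const_mul _

lemma energySq_toeplitz₂_nonneg {g : ℝ × ℝ → ℝ} (hg : Continuous g)
    (hg0 : ∀ θ ∈ torusBox, 0 ≤ g θ) {n₁ n₂ : ℕ} (x : Fin n₁ × Fin n₂ → ℂ) :
    0 ≤ energySq (toeplitz₂ n₁ n₂ (fun θ => (g θ : ℂ))) x := by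
  have h : (1 / (2 * (Real.pi : ℂ)) ^ 2 *
        ∫ θ in torusBox, (g θ : ℂ) * (Complex.normSq (trigPoly x θ) : ℂ)) =
      ((1 / (2 * Real.pi) ^ 2 * ∫ θ in torusBox, g θ * Complex.normSq (trigPoly x θ) : ℝ) : ℂ) := by
    simp only [← Complex.ofReal_mul]
    rw [integral_complex_ofReal]
    push_cast
    ring
  rw [energySq, dotProduct_toeplitz₂ (by fun_prop), h, Complex.ofReal_re]
  refine mul_nonneg (by positivity) (MeasureTheory.setIntegral_nonneg
    isCompact_torusBox.measurableSet fun θ hθ => mul_nonneg (hg0 θ hθ) (Complex.normSq_nonneg _))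

lemma energySq_add {ι : Type*} [Fintype ι] (X Y : Matrix ι ι ℂ) (x : ι → ℂ) :
    energySq (X + Y) x = energySq X x + energySq Y x := by
  simp [energySq, Matrix.add_mulVec]

lemma energySq_smul {ι : Type*} [Fintype ι] (c : ℝ) (X : Matrix ι ι ℂ) (x : ι → ℂ) :
    energySq ((c : ℂ) • X) x = c * energySq X x := by
  simp [energySq, Matrix.smul_mulVec]

lemma energySq_toeplitz₂_mono {f g : ℝ × ℝ → ℝ} (hf : Continuous f) (hg : Continuous g)
    (hfg : ∀ θ ∈ torusBox, f θ ≤ g θ) {n₁ n₂ : ℕ} (x : Fin n₁ × Fin n₂ → ℂ) :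
    energySq (toeplitz₂ n₁ n₂ (fun θ => (f θ : ℂ))) x ≤
      energySq (toeplitz₂ n₁ n₂ (fun θ => (g θ : ℂ))) x := by
  have h : (fun θ => (g θ : ℂ)) = fun θ => (f θ : ℂ) + ((g θ - f θ : ℝ) : ℂ) := by
    ext θ; push_cast; ring
  rw [h, toeplitz₂_add (by fun_prop) (by fun_prop), energySq_add]
  have := energySq_toeplitz₂_nonneg (g := fun θ => g θ - f θ) (hg.sub hf)
    (fun θ hθ => sub_nonneg.2 (hfg θ hθ)) x
  linarith

lemma norm_fourierCoeff₂_le {g : ℝ × ℝ → ℂ} {C : ℝ} (hC : ∀ θ ∈ torusBox, ‖g θ‖ ≤ C)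
    (k₁ k₂ : ℤ) : ‖fourierCoeff₂ g k₁ k₂‖ ≤ C := by
  have hvol : MeasureTheory.volume.real torusBox = (2 * Real.pi) ^ 2 := by
    rw [torusBox, MeasureTheory.Measure.volume_eq_prod, MeasureTheory.measureReal_prod_prod,
      Real.volume_real_Icc_of_le (by linarith [Real.pi_pos])]
    ring
  have h := MeasureTheory.norm_setIntegral_le_of_norm_le_const (C := C)
    (μ := MeasureTheory.volume) (s := torusBox)
    (f := fun θ => g θ *
      Complex.exp (-Complex.I * ((k₁ : ℂ) * (θ.1 : ℂ) + (k₂ : ℂ) * (θ.2 : ℂ))))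
    isCompact_torusBox.measure_lt_top (by
      intro θ hθ
      have : -Complex.I * ((k₁ : ℂ) * (θ.1 : ℂ) + (k₂ : ℂ) * (θ.2 : ℂ)) =
        ((-(k₁ * θ.1 + k₂ * θ.2) : ℝ) : ℂ) * Complex.I := by push_cast; ring
      rw [norm_mul, this, Complex.norm_exp_ofReal_mul_I, mul_one]
      exact hC θ hθ)
  rw [hvol] at h
  rw [fourierCoeff₂_eq, norm_mul]
  have hn : ‖1 / (2 * (Real.pi : ℂ)) ^ 2‖ = 1 / (2 * Real.pi) ^ 2 := by
    simp [abs_of_pos Real.pi_pos]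
  rw [hn, one_div, inv_mul_le_iff₀ (by positivity), mul_comm]
  exact h

/-! ### Tensor-product cosine symbols and tridiagonal matrices. -/

/-- The tridiagonal Toeplitz matrix with symbol `1 + t cos`. -/
noncomputable def tridiag (n : ℕ) (t : ℝ) : Matrix (Fin n) (Fin n) ℂ :=
  fun i j => if (i : ℕ) = j then 1
    else if (i : ℕ) + 1 = j ∨ (j : ℕ) + 1 = i then (t : ℂ) / 2 else 0

lemma integral_exp_int (k : ℤ) :
    ∫ u in Set.Icc (-Real.pi) Real.pi, Complex.exp (-Complex.I * (k * (u : ℂ))) =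
      if k = 0 then 2 * (Real.pi : ℂ) else 0 := by
  rw [MeasureTheory.integral_Icc_eq_integral_Ioc,
    ← intervalIntegral.integral_of_le (by linarith [Real.pi_pos])]
  split_ifs with hk
  · subst hk
    simp
    ring
  · have hc : -Complex.I * (k : ℂ) ≠ 0 := by simp [hk]
    simp only [← mul_assoc]
    rw [integral_exp_mul_complex hc]
    have : -Complex.I * (k : ℂ) * (Real.pi : ℂ) =
        -Complex.I * (k : ℂ) * ((-Real.pi : ℝ) : ℂ) + ((-k : ℤ) : ℂ) * (2 * Real.pi * Complex.I) := by
      push_cast; ring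
    rw [this, Complex.exp_add, Complex.exp_int_mul_two_pi_mul_I, mul_one, sub_self, zero_div]

lemma integral_one_add_cos (t : ℝ) (k : ℤ) :
    ∫ u in Set.Icc (-Real.pi) Real.pi,
        ((1 + t * Real.cos u : ℝ) : ℂ) * Complex.exp (-Complex.I * (k * (u : ℂ))) =
      2 * (Real.pi : ℂ) * (if k = 0 then 1 else if k = 1 ∨ k = -1 then (t : ℂ) / 2 else 0) := by
  have hpt : ∀ u : ℝ, ((1 + t * Real.cos u : ℝ) : ℂ) * Complex.exp (-Complex.I * (k * (u : ℂ))) =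
      Complex.exp (-Complex.I * (k * (u : ℂ))) +
        (t : ℂ) / 2 * Complex.exp (-Complex.I * (((k - 1 : ℤ) : ℂ) * (u : ℂ))) +
        (t : ℂ) / 2 * Complex.exp (-Complex.I * (((k + 1 : ℤ) : ℂ) * (u : ℂ))) := by
    intro u
    have h1 : -Complex.I * (((k - 1 : ℤ) : ℂ) * (u : ℂ)) =
        u * Complex.I + -Complex.I * (k * (u : ℂ)) := by push_cast; ring
    have h2 : -Complex.I * (((k + 1 : ℤ) : ℂ) * (u : ℂ)) =
        -u * Complex.I + -Complex.I * (k * (u : ℂ)) := by push_cast; ring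
    rw [h1, h2, Complex.exp_add, Complex.exp_add]
    push_cast
    rw [Complex.cos]
    ring
  have hint : ∀ (c : ℂ) (m : ℤ), MeasureTheory.IntegrableOn
      (fun u : ℝ => c * Complex.exp (-Complex.I * ((m : ℂ) * (u : ℂ))))
      (Set.Icc (-Real.pi) Real.pi) := by
    intro c m
    apply ContinuousOn.integrableOn_compact isCompact_Icc
    fun_prop
  have hint1 := hint 1 k
  simp only [one_mul] at hint1
  simp only [hpt]
  have hint2 : MeasureTheory.IntegrableOn (fun u : ℝ => Complex.exp (-Complex.I * (k * (u : ℂ))) +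
      (t : ℂ) / 2 * Complex.exp (-Complex.I * (((k - 1 : ℤ) : ℂ) * (u : ℂ))))
      (Set.Icc (-Real.pi) Real.pi) := hint1.add (hint _ _)
  rw [MeasureTheory.integral_add hint2 (hint _ _),
    MeasureTheory.integral_add hint1 (hint _ _), MeasureTheory.integral_const_mul,
    MeasureTheory.integral_const_mul, integral_exp_int, integral_exp_int, integral_exp_int]
  rcases eq_or_ne k 0 with rfl | h0
  · simp
  rcases eq_or_ne k 1 with rfl | h1
  · simp; ring
  rcases eq_or_ne k (-1) with rfl | h2
  · simp; ring
  have h3 : k - 1 ≠ 0 := by omega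
  have h4 : k + 1 ≠ 0 := by omega
  simp [h0, h1, h2, h3, h4]

/-- By Fubini the coefficients of a product symbol factor. The parameters cover the transfer
operator (`1, 1`) and both Laplacian terms (`-1, 0` and `0, -1`). -/
lemma toeplitz₂_one_add_cos (n₁ n₂ : ℕ) (s t : ℝ) :
    toeplitz₂ n₁ n₂ (fun θ => (((1 + s * Real.cos θ.1) * (1 + t * Real.cos θ.2) : ℝ) : ℂ)) =
      tridiag n₁ s ⊗ₖ tridiag n₂ t := by
  ext i j
  rw [Matrix.kroneckerMap_apply, toeplitz₂, fourierCoeff₂]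
  have hpt : ∀ (k₁ k₂ : ℤ) (θ : ℝ × ℝ),
      (((1 + s * Real.cos θ.1) * (1 + t * Real.cos θ.2) : ℝ) : ℂ) *
        Complex.exp (-Complex.I * ((k₁ : ℂ) * (θ.1 : ℂ) + (k₂ : ℂ) * (θ.2 : ℂ))) =
      (((1 + s * Real.cos θ.1 : ℝ) : ℂ) * Complex.exp (-Complex.I * (k₁ * (θ.1 : ℂ)))) *
      (((1 + t * Real.cos θ.2 : ℝ) : ℂ) * Complex.exp (-Complex.I * (k₂ * (θ.2 : ℂ)))) := by
    intro k₁ k₂ θ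
    rw [mul_mul_mul_comm, ← Complex.exp_add, ← Complex.ofReal_mul]
    ring_nf
  have hentry : ∀ {n : ℕ} (t : ℝ) (i j : Fin n),
      (if ((i : ℕ) : ℤ) - ((j : ℕ) : ℤ) = 0 then 1 else
        if ((i : ℕ) : ℤ) - ((j : ℕ) : ℤ) = 1 ∨ ((i : ℕ) : ℤ) - ((j : ℕ) : ℤ) = -1
        then (t : ℂ) / 2 else 0) = tridiag n t i j := by
    intro n t i j
    rw [tridiag]
    have h1 : (((i : ℕ) : ℤ) - ((j : ℕ) : ℤ) = 0) ↔ (i : ℕ) = j := by omega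
    have h2 : (((i : ℕ) : ℤ) - ((j : ℕ) : ℤ) = 1 ∨ ((i : ℕ) : ℤ) - ((j : ℕ) : ℤ) = -1) ↔
        ((i : ℕ) + 1 = j ∨ (j : ℕ) + 1 = i) := by omega
    simp only [h1, h2]
  simp only [hpt]
  rw [MeasureTheory.Measure.volume_eq_prod, MeasureTheory.setIntegral_prod_mul
    (fun u : ℝ => ((1 + s * Real.cos u : ℝ) : ℂ) * Complex.exp (-Complex.I * (_ * (u : ℂ))))
    (fun u : ℝ => ((1 + t * Real.cos u : ℝ) : ℂ) * Complex.exp (-Complex.I * (_ * (u : ℂ)))),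
    integral_one_add_cos, integral_one_add_cos, hentry, hentry]
  have hpi : (Real.pi : ℂ) ≠ 0 := by exact_mod_cast Real.pi_ne_zero
  field_simp
-- Zero extension and the Dirichlet energy.
/-- Extension of a vector by zero: index `k + 1` holds entry `k`, all other entries vanish. -/
def zeroPad {n : ℕ} (v : Fin n → ℂ) : ℕ → ℂ
  | 0 => 0
  | k + 1 => if h : k < n then v ⟨k, h⟩ else 0

lemma zeroPad_succ {n : ℕ} (v : Fin n → ℂ) (i : Fin n) : zeroPad v (i + 1) = v i := by
  simp [zeroPad]

lemma sum_ite_val_eq {n : ℕ} (v : Fin n → ℂ) (k : ℕ) :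
    (∑ j : Fin n, if k = (j : ℕ) then v j else 0) = zeroPad v (k + 1) := by
  rw [zeroPad]
  split_ifs with h
  · rw [Finset.sum_eq_single ⟨k, h⟩]
    · simp
    · intro j _ hj
      rw [if_neg]
      rintro rfl
      exact hj rfl
    · simp
  · refine Finset.sum_eq_zero fun j _ => if_neg ?_
    have := j.isLt
    omega

lemma tridiag_mulVec {n : ℕ} (t : ℝ) (v : Fin n → ℂ) (i : Fin n) :
    (tridiag n t).mulVec v i =
      zeroPad v (i + 1) + (t : ℂ) / 2 * (zeroPad v i + zeroPad v (i + 2)) := by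
  have hpt : ∀ j : Fin n, tridiag n t i j * v j =
      (if (i : ℕ) = j then v j else 0) + (t : ℂ) / 2 *
        ((if (j : ℕ) + 1 = i then v j else 0) + (if (i : ℕ) + 1 = j then v j else 0)) := by
    intro j
    unfold tridiag
    split_ifs <;> first | omega | simp
  rw [Matrix.mulVec, dotProduct]
  simp only [hpt]
  rw [Finset.sum_add_distrib, ← Finset.mul_sum, Finset.sum_add_distrib, sum_ite_val_eq,
    sum_ite_val_eq]
  congr 3
  rcases i with ⟨_ | k, hk⟩
  · simp [zeroPad]
  · simp only [← sum_ite_val_eq, add_left_inj]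
    simp only [eq_comm]

/-- Squared Euclidean norm. -/
noncomputable def sumSq {ι : Type*} [Fintype ι] (v : ι → ℂ) : ℝ := ∑ i, ‖v i‖ ^ 2

/-- Dirichlet energy: the sum of the squared differences of the zero extension. -/
noncomputable def dirichletSq {n : ℕ} (v : Fin n → ℂ) : ℝ :=
  ∑ i ∈ Finset.range (n + 1), ‖zeroPad v (i + 1) - zeroPad v i‖ ^ 2

lemma norm_add_sq_le (a b : ℂ) : ‖a + b‖ ^ 2 ≤ 2 * ‖a‖ ^ 2 + 2 * ‖b‖ ^ 2 := by
  have h := norm_add_le a b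
  have h1 := norm_nonneg (a + b)
  nlinarith [sq_nonneg (‖a‖ - ‖b‖)]

lemma norm_sub_sq_le (a b : ℂ) : ‖a - b‖ ^ 2 ≤ 2 * ‖a‖ ^ 2 + 2 * ‖b‖ ^ 2 := by
  simpa [sub_eq_add_neg] using norm_add_sq_le a (-b)

lemma sumSq_add_le {ι : Type*} [Fintype ι] (v w : ι → ℂ) :
    sumSq (v + w) ≤ 2 * sumSq v + 2 * sumSq w := by
  rw [sumSq, sumSq, sumSq, Finset.mul_sum, Finset.mul_sum, ← Finset.sum_add_distrib]
  exact Finset.sum_le_sum fun i _ => norm_add_sq_le _ _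

lemma sumSq_sub_le {ι : Type*} [Fintype ι] (v w : ι → ℂ) :
    sumSq (v - w) ≤ 2 * sumSq v + 2 * sumSq w := by
  rw [sumSq, sumSq, sumSq, Finset.mul_sum, Finset.mul_sum, ← Finset.sum_add_distrib]
  exact Finset.sum_le_sum fun i _ => norm_sub_sq_le _ _

lemma sumSq_eq_sum_range {n : ℕ} (v : Fin n → ℂ) :
    sumSq v = ∑ i ∈ Finset.range n, ‖zeroPad v (i + 1)‖ ^ 2 := by
  rw [sumSq, ← Fin.sum_univ_eq_sum_range (fun i => ‖zeroPad v (i + 1)‖ ^ 2)]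
  simp only [zeroPad_succ]

lemma zeroPad_last {n : ℕ} (v : Fin n → ℂ) : zeroPad v (n + 1) = 0 := by simp [zeroPad]

lemma summation_by_parts (V : ℕ → ℂ) (n : ℕ) :
    2 * ∑ i ∈ Finset.range n, (star (V (i + 1)) *
        (V (i + 1) + ((-1 : ℝ) : ℂ) / 2 * (V i + V (i + 2)))).re =
      ∑ i ∈ Finset.range n, ‖V (i + 1) - V i‖ ^ 2 + (star (V 0) * (V 1 - V 0)).re -
        (star (V n) * (V (n + 1) - V n)).re := by
  induction n with
  | zero => simp
  | succ n ih =>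
    rw [Finset.sum_range_succ, mul_add, ih, Finset.sum_range_succ]
    simp only [← Complex.normSq_eq_norm_sq, Complex.normSq_apply]
    simp
    ring

lemma two_mul_energySq_tridiag {n : ℕ} (v : Fin n → ℂ) :
    2 * energySq (tridiag n (-1)) v = dirichletSq v := by
  have h := summation_by_parts (zeroPad v) n
  rw [← Fin.sum_univ_eq_sum_range (fun i => (star (zeroPad v (i + 1)) *
        (zeroPad v (i + 1) + ((-1 : ℝ) : ℂ) / 2 * (zeroPad v i + zeroPad v (i + 2)))).re)] at h
  rw [energySq, dotProduct, Complex.re_sum]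
  simp only [tridiag_mulVec, Pi.star_apply]
  simp only [zeroPad_succ] at h ⊢
  -- The left boundary term vanishes, and the right one is the last squared difference, the jump
  -- down to zero.
  rw [h, dirichletSq, Finset.sum_range_succ, zeroPad_last]
  have h0 : zeroPad v 0 = 0 := rfl
  rw [h0]
  simp only [← Complex.normSq_eq_norm_sq, Complex.normSq_apply]
  simp
  ring

lemma dirichletSq_nonneg {n : ℕ} (v : Fin n → ℂ) : 0 ≤ dirichletSq v :=
  Finset.sum_nonneg fun _ _ => by positivity

/-- Each entry is half a difference of two consecutive increments, so its square is at most half the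
sum of their squares; every increment is used at most twice. -/
lemma sumSq_tridiag_mulVec_le {n : ℕ} (v : Fin n → ℂ) :
    sumSq ((tridiag n (-1)).mulVec v) ≤ dirichletSq v := by
  have hpt : ∀ i : Fin n, ‖(tridiag n (-1)).mulVec v i‖ ^ 2 ≤
      1 / 2 * ‖zeroPad v (i + 1) - zeroPad v i‖ ^ 2 +
      1 / 2 * ‖zeroPad v (i + 1 + 1) - zeroPad v (i + 1)‖ ^ 2 := by
    intro i
    rw [tridiag_mulVec]
    have : zeroPad v (i + 1) + ((-1 : ℝ) : ℂ) / 2 * (zeroPad v i + zeroPad v (i + 2)) =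
      (1 / 2 : ℝ) * ((zeroPad v (i + 1) - zeroPad v i) -
        (zeroPad v (i + 1 + 1) - zeroPad v (i + 1))) := by push_cast; ring
    rw [this, norm_mul, mul_pow, Complex.norm_real]
    have := norm_sub_sq_le (zeroPad v (i + 1) - zeroPad v i)
      (zeroPad v (i + 1 + 1) - zeroPad v (i + 1))
    norm_num
    linarith
  refine (Finset.sum_le_sum fun i _ => hpt i).trans ?_
  rw [Finset.sum_add_distrib, ← Finset.mul_sum, ← Finset.mul_sum,
    Fin.sum_univ_eq_sum_range (fun i => ‖zeroPad v (i + 1) - zeroPad v i‖ ^ 2),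
    Fin.sum_univ_eq_sum_range (fun i => ‖zeroPad v (i + 1 + 1) - zeroPad v (i + 1)‖ ^ 2)]
  have h1 : dirichletSq v = _ := Finset.sum_range_succ _ _
  have h2 : dirichletSq v = _ := Finset.sum_range_succ' _ _
  have h3 := sq_nonneg ‖zeroPad v (n + 1) - zeroPad v n‖
  have h4 := sq_nonneg ‖zeroPad v (0 + 1) - zeroPad v 0‖
  linarith

lemma dirichletSq_le {n : ℕ} (v : Fin n → ℂ) : dirichletSq v ≤ 4 * sumSq v := by
  refine (Finset.sum_le_sum fun i _ => norm_sub_sq_le _ _).trans ?_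
  rw [Finset.sum_add_distrib, ← Finset.mul_sum, ← Finset.mul_sum, Finset.sum_range_succ,
    Finset.sum_range_succ', sumSq_eq_sum_range, zeroPad_last]
  simp [zeroPad]
  linarith

/-- The energy includes the jump from the boundary value zero, so zero propagates along the indices.
-/
lemma dirichletSq_eq_zero {n : ℕ} {v : Fin n → ℂ} (h : dirichletSq v = 0) : v = 0 := by
  rw [dirichletSq, Finset.sum_eq_zero_iff_of_nonneg (fun _ _ => by positivity)] at h
  have hz : ∀ k, k ≤ n → zeroPad v k = 0 := by
    intro k
    induction k with
    | zero => intro _; rfl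
    | succ k ih =>
      intro hk
      have := h k (Finset.mem_range.2 (by omega))
      rw [ih (by omega), sub_zero] at this
      simpa using this
  ext i
  rw [← zeroPad_succ v i, hz _ i.isLt]
  rfl

/-! ### Linear interpolation and its error, in one and two dimensions. -/

/-- Indicator of the (zero-based) even indices, which are the points dropped by `downSample`. -/
def fineMask (n : ℕ) : Fin n → ℂ := fun i => if Even (i : ℕ) then 1 else 0

lemma downSample_mul_transpose {n : ℕ} (hn : Odd n) :
    downSample n * (downSample n).transpose = Matrix.diagonal (1 - fineMask n) := by
  obtain ⟨m, rfl⟩ := hn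
  have hK : ∀ (i : Fin (2 * m + 1)) (l : Fin (coarseSize (2 * m + 1))),
      downSample (2 * m + 1) i l = if (i : ℕ) = 2 * l + 1 then 1 else 0 := by
    intro i l
    unfold downSample
    have : ((i : ℕ) + 1 = 2 * ((l : ℕ) + 1) - (2 * m + 1 + 1) % 2) ↔ (i : ℕ) = 2 * l + 1 := by
      omega
    simp only [this]
  have hm : coarseSize (2 * m + 1) = m := by unfold coarseSize; omega
  ext i j
  rw [Matrix.mul_apply]
  simp only [Matrix.transpose_apply, hK]
  rcases Nat.even_or_odd (i : ℕ) with hi | hi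
  · rw [Finset.sum_eq_zero]
    · rw [Matrix.diagonal_apply]
      simp [fineMask, hi]
    · intro l _
      rw [if_neg, zero_mul]
      intro h
      rw [h] at hi
      exact (Nat.not_even_iff_odd.2 ⟨l, rfl⟩) hi
  · obtain ⟨l, hl⟩ := hi
    have hlt : l < coarseSize (2 * m + 1) := by have := i.isLt; omega
    rw [Finset.sum_eq_single ⟨l, hlt⟩]
    · rw [Matrix.diagonal_apply]
      have hij : (i = j) ↔ (j : ℕ) = 2 * l + 1 := by rw [Fin.ext_iff]; omega
      simp [fineMask, hl, hij]
    · intro b _ hb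
      rw [if_neg, zero_mul]
      intro h
      exact hb (Fin.ext (by simp only; omega))
    · simp

/-- Neighbouring indices have opposite parity, so both sides describe interpolation: kept entries
are copied, dropped ones become the mean of their neighbours, with zero beyond the ends. -/
lemma tridiag_mul_diagonal (n : ℕ) :
    tridiag n 1 * Matrix.diagonal (1 - fineMask n) =
      1 - Matrix.diagonal (fineMask n) * tridiag n (-1) := by
  ext i j
  rw [Matrix.mul_diagonal, Matrix.sub_apply, Matrix.diagonal_mul, Matrix.one_apply]
  unfold tridiag fineMask
  by_cases h : (i : ℕ) = j
  · have : i = j := Fin.ext h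
    simp [this]
  · have hne : i ≠ j := fun h' => h (congrArg _ h')
    by_cases h2 : (i : ℕ) + 1 = j ∨ (j : ℕ) + 1 = i
    · have hp : Even (j : ℕ) ↔ ¬ Even (i : ℕ) := by
        rcases h2 with h2 | h2 <;> simp [← h2, Nat.even_add_one]
      by_cases hi : Even (i : ℕ) <;> simp [h, hne, h2, hp, hi] <;> ring
    · simp [h, hne, h2]

/-- The interpolation error operator in one dimension. -/
noncomputable def interpError (n : ℕ) : Matrix (Fin n) (Fin n) ℂ :=
  Matrix.diagonal (fineMask n) * tridiag n (-1)

lemma sumSq_interpError_le {n : ℕ} (v : Fin n → ℂ) :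
    sumSq ((interpError n).mulVec v) ≤ dirichletSq v := by
  refine le_trans ?_ (sumSq_tridiag_mulVec_le v)
  refine Finset.sum_le_sum fun i _ => ?_
  rw [interpError, ← Matrix.mulVec_mulVec, Matrix.mulVec_diagonal, fineMask]
  split_ifs <;> simp

lemma sumSq_one_sub_interpError_le {n : ℕ} (v : Fin n → ℂ) :
    sumSq ((1 - interpError n).mulVec v) ≤ 10 * sumSq v := by
  rw [Matrix.sub_mulVec, Matrix.one_mulVec]
  have h1 := sumSq_sub_le v ((interpError n).mulVec v)
  have h2 := sumSq_interpError_le v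
  have h3 := dirichletSq_le v
  linarith

lemma kronecker_one_mulVec {m n : ℕ} (B : Matrix (Fin m) (Fin m) ℂ) (x : Fin m × Fin n → ℂ)
    (i : Fin m) (j : Fin n) :
    (B ⊗ₖ (1 : Matrix (Fin n) (Fin n) ℂ)).mulVec x (i, j) = B.mulVec (fun a => x (a, j)) i := by
  simp [Matrix.mulVec, dotProduct, Fintype.sum_prod_type, Matrix.one_apply]

lemma one_kronecker_mulVec {m n : ℕ} (B : Matrix (Fin n) (Fin n) ℂ) (x : Fin m × Fin n → ℂ)
    (i : Fin m) (j : Fin n) :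
    ((1 : Matrix (Fin m) (Fin m) ℂ) ⊗ₖ B).mulVec x (i, j) = B.mulVec (fun b => x (i, b)) j := by
  simp [Matrix.mulVec, dotProduct, Fintype.sum_prod_type, Matrix.one_apply]

lemma sumSq_prod {m n : ℕ} (x : Fin m × Fin n → ℂ) :
    sumSq x = ∑ i, sumSq (fun j => x (i, j)) := by
  simp only [sumSq, Fintype.sum_prod_type]

lemma sumSq_prod_right {m n : ℕ} (x : Fin m × Fin n → ℂ) :
    sumSq x = ∑ j, sumSq (fun i => x (i, j)) := by
  simp only [sumSq, Fintype.sum_prod_type_right]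

lemma energySq_kronecker_one {m n : ℕ} (B : Matrix (Fin m) (Fin m) ℂ) (x : Fin m × Fin n → ℂ) :
    energySq (B ⊗ₖ (1 : Matrix (Fin n) (Fin n) ℂ)) x = ∑ j, energySq B (fun i => x (i, j)) := by
  simp only [energySq, dotProduct, Fintype.sum_prod_type_right, kronecker_one_mulVec,
    Complex.re_sum, Pi.star_apply]

lemma energySq_one_kronecker {m n : ℕ} (B : Matrix (Fin n) (Fin n) ℂ) (x : Fin m × Fin n → ℂ) :
    energySq ((1 : Matrix (Fin m) (Fin m) ℂ) ⊗ₖ B) x = ∑ i, energySq B (fun j => x (i, j)) := by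
  simp only [energySq, dotProduct, Fintype.sum_prod_type, one_kronecker_mulVec,
    Complex.re_sum, Pi.star_apply]

lemma sumSq_interpolation_le {m n : ℕ} (x : Fin m × Fin n → ℂ) :
    sumSq (x - ((1 - interpError m) ⊗ₖ (1 - interpError n)).mulVec x) ≤
      40 * (energySq (tridiag m (-1) ⊗ₖ (1 : Matrix (Fin n) (Fin n) ℂ)) x +
        energySq ((1 : Matrix (Fin m) (Fin m) ℂ) ⊗ₖ tridiag n (-1)) x) := by
  set E₁ := interpError m
  set E₂ := interpError n
  set z := ((1 : Matrix (Fin m) (Fin m) ℂ) ⊗ₖ E₂).mulVec x with hz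
  -- Telescoping `I - (I - E₁) ⊗ (I - E₂) = E₁ ⊗ I + (I - E₁) ⊗ E₂` leaves one error factor per
  -- term, acting along a single direction.
  have hsplit : x - ((1 - E₁) ⊗ₖ (1 - E₂)).mulVec x =
      (E₁ ⊗ₖ (1 : Matrix (Fin n) (Fin n) ℂ)).mulVec x +
        ((1 - E₁) ⊗ₖ (1 : Matrix (Fin n) (Fin n) ℂ)).mulVec z := by
    rw [hz, Matrix.mulVec_mulVec, ← Matrix.mul_kronecker_mul, mul_one, one_mul,
      ← Matrix.add_mulVec, sub_eq_iff_eq_add, ← Matrix.add_mulVec]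
    have : E₁ ⊗ₖ (1 : Matrix (Fin n) (Fin n) ℂ) + (1 - E₁) ⊗ₖ E₂ + (1 - E₁) ⊗ₖ (1 - E₂) = 1 := by
      rw [add_assoc, ← Matrix.kronecker_add, ← Matrix.one_kronecker_one]
      rw [add_sub_cancel, ← Matrix.add_kronecker, add_sub_cancel]
    rw [this, Matrix.one_mulVec]
  have h1 : sumSq ((E₁ ⊗ₖ (1 : Matrix (Fin n) (Fin n) ℂ)).mulVec x) ≤
      2 * energySq (tridiag m (-1) ⊗ₖ (1 : Matrix (Fin n) (Fin n) ℂ)) x := by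
    rw [sumSq_prod_right, energySq_kronecker_one, Finset.mul_sum]
    simp only [kronecker_one_mulVec, two_mul_energySq_tridiag]
    exact Finset.sum_le_sum fun j _ => sumSq_interpError_le _
  have h2 : sumSq z ≤ 2 * energySq ((1 : Matrix (Fin m) (Fin m) ℂ) ⊗ₖ tridiag n (-1)) x := by
    rw [sumSq_prod, energySq_one_kronecker, Finset.mul_sum]
    simp only [hz, one_kronecker_mulVec, two_mul_energySq_tridiag]
    exact Finset.sum_le_sum fun j _ => sumSq_interpError_le _
  have h3 : sumSq (((1 - E₁) ⊗ₖ (1 : Matrix (Fin n) (Fin n) ℂ)).mulVec z) ≤ 10 * sumSq z := by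
    rw [sumSq_prod_right, sumSq_prod_right z, Finset.mul_sum]
    simp only [kronecker_one_mulVec]
    exact Finset.sum_le_sum fun j _ => sumSq_one_sub_interpError_le _
  -- The two energies enter with factors `2 · 2` and `2 · 10 · 2`, whence `40`.
  have h4 := sumSq_add_le ((E₁ ⊗ₖ (1 : Matrix (Fin n) (Fin n) ℂ)).mulVec x)
    (((1 - E₁) ⊗ₖ (1 : Matrix (Fin n) (Fin n) ℂ)).mulVec z)
  have h5 : 0 ≤ sumSq ((E₁ ⊗ₖ (1 : Matrix (Fin n) (Fin n) ℂ)).mulVec x) :=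
    Finset.sum_nonneg fun _ _ => by positivity
  rw [hsplit]
  linarith

/-- Sampling followed by prolongation is the tensor product of the one-dimensional interpolations,
since `K Kᵀ` is the diagonal projection onto the kept points. -/
lemma projector_mulVec_restriction {n₁ n₂ : ℕ} (h₁ : Odd n₁) (h₂ : Odd n₂)
    (x : Fin n₁ × Fin n₂ → ℂ) :
    (projector n₁ n₂).mulVec ((downSample n₁ ⊗ₖ downSample n₂).transpose.mulVec x) =
      ((1 - interpError n₁) ⊗ₖ (1 - interpError n₂)).mulVec x := by
  have hp : toeplitz₂ n₁ n₂ pSymbol = tridiag n₁ 1 ⊗ₖ tridiag n₂ 1 := by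
    rw [← toeplitz₂_one_add_cos]
    simp only [one_mul]
    rfl
  rw [Matrix.mulVec_mulVec, projector, hp, Matrix.mul_assoc, ← Matrix.kroneckerMap_transpose,
    ← Matrix.mul_kronecker_mul, ← Matrix.mul_kronecker_mul, downSample_mul_transpose h₁,
    downSample_mul_transpose h₂, tridiag_mul_diagonal, tridiag_mul_diagonal]
  rfl

/-! ### Existence of the minimizer. -/

/-- The range of `B` is finite-dimensional, hence complete, so a nearest point exists. -/
lemma exists_isMinOn_sumSq {ι κ : Type*} [Fintype ι] [Fintype κ] (B : Matrix ι κ ℂ)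
    (x : ι → ℂ) : ∃ y, ∀ z, sumSq (x - B.mulVec y) ≤ sumSq (x - B.mulVec z) := by
  let K : Submodule ℂ (EuclideanSpace ℂ ι) :=
    LinearMap.range ((WithLp.linearEquiv 2 ℂ (ι → ℂ)).symm.toLinearMap ∘ₗ B.mulVecLin)
  have hn : ∀ v : ι → ℂ, sumSq v = ‖WithLp.toLp 2 v‖ ^ 2 := by
    intro v
    rw [EuclideanSpace.norm_sq_eq]
    rfl
  obtain ⟨w, ⟨y, rfl⟩, hw⟩ := K.exists_norm_eq_iInf_of_complete_subspace
    K.complete_of_finiteDimensional (WithLp.toLp 2 x)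
  refine ⟨y, fun z => ?_⟩
  rw [hn, hn]
  refine pow_le_pow_left₀ (norm_nonneg _) ?_ 2
  refine hw.le.trans ?_
  exact ciInf_le (f := fun w : (K : Set (EuclideanSpace ℂ ι)) => ‖WithLp.toLp 2 x - w‖)
    ⟨0, by rintro _ ⟨_, rfl⟩; positivity⟩ ⟨WithLp.toLp 2 (B.mulVec z), ⟨z, rfl⟩⟩

lemma energySq_diagonal_const {ι : Type*} [Fintype ι] [DecidableEq ι] (δ : ℂ) (v : ι → ℂ) :
    energySq (Matrix.diagonal fun _ => δ) v = δ.re * sumSq v := by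
  rw [energySq, sumSq, dotProduct, Complex.re_sum, Finset.mul_sum]
  refine Finset.sum_congr rfl fun i _ => ?_
  rw [Matrix.mulVec_diagonal, Pi.star_apply, RCLike.star_def, mul_left_comm, Complex.conj_mul',
    ← Complex.ofReal_pow, Complex.re_mul_ofReal]
-- Uniform bounds along the sequence and conclusion.
-- Positivity of every term lets the finitely many initial ones be absorbed into the constants, so
-- the bounds hold for all `j`.
lemma exists_pos_bounds_of_isTheta_one {f : ℕ → ℝ} (hf : ∀ j, 0 < f j)
    (h : f =Θ[atTop] fun _ => (1 : ℝ)) : ∃ κ K : ℝ, 0 < κ ∧ 0 < K ∧ ∀ j, κ ≤ f j ∧ f j ≤ K := by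
  obtain ⟨K, hK, hK'⟩ := bound_of_isBigO_nat_atTop h.1
  obtain ⟨C, hC, hC'⟩ := bound_of_isBigO_nat_atTop h.2
  refine ⟨C⁻¹, K, inv_pos.2 hC, hK, fun j => ⟨?_, ?_⟩⟩
  · have := hC' (hf j).ne'
    rw [norm_one, Real.norm_of_nonneg (hf j).le] at this
    rwa [inv_le_iff_one_le_mul₀' hC]
  · have := hK' (x := j) one_ne_zero
    rwa [norm_one, mul_one, Real.norm_of_nonneg (hf j).le] at this

/-- The real-valued version of `Fsymbol`, with `ρ` in place of `s / r`. -/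
noncomputable def realSymbol (α β d e ρ : ℝ) (θ : ℝ × ℝ) : ℝ :=
  d * (qSymbol α θ.1).re + e * ρ * (qSymbol β θ.2).re

lemma Fsymbol_eq_ofReal (α β d e r s : ℝ) :
    Fsymbol α β d e r s = fun θ => (realSymbol α β d e (s / r) θ : ℂ) := by
  ext θ
  simp only [Fsymbol, realSymbol, qSymbol_eq_ofReal, Complex.ofReal_re]
  push_cast
  ring

lemma realSymbol_continuous {α β : ℝ} (hα : 0 < α) (hβ : 0 < β) (d e ρ : ℝ) :
    Continuous (realSymbol α β d e ρ) := by
  have h1 := qSymbol_continuous hα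
  have h2 := qSymbol_continuous hβ
  exact (continuous_const.mul (Complex.continuous_re.comp (h1.comp continuous_fst))).add
    (continuous_const.mul (Complex.continuous_re.comp (h2.comp continuous_snd)))

lemma laplacian_le_realSymbol {α β d e ρ κ : ℝ} (hα : α ∈ Set.Ioo (1 : ℝ) 2)
    (hβ : β ∈ Set.Ioo (1 : ℝ) 2) (hd : 0 < d) (he : 0 < e) (hκ : 0 < κ) (hρ : κ ≤ ρ)
    {θ : ℝ × ℝ} (hθ : θ ∈ torusBox) :
    min (d * qLowerConst α) (e * κ * qLowerConst β) *
      ((1 - Real.cos θ.1) + (1 - Real.cos θ.2)) ≤ realSymbol α β d e ρ θ := by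
  have h1 := qLowerConst_mul_le hα hθ.1
  have h2 := qLowerConst_mul_le hβ hθ.2
  have c1 : 0 ≤ 1 - Real.cos θ.1 := by linarith [Real.cos_le_one θ.1]
  have c2 : 0 ≤ 1 - Real.cos θ.2 := by linarith [Real.cos_le_one θ.2]
  have h3 := mul_le_mul_of_nonneg_right
    (min_le_left (d * qLowerConst α) (e * κ * qLowerConst β)) c1
  have h4 := mul_le_mul_of_nonneg_right
    (min_le_right (d * qLowerConst α) (e * κ * qLowerConst β)) c2
  have h5 := mul_le_mul_of_nonneg_left h1 hd.le
  have h6 : e * κ * (qLowerConst β * (1 - Real.cos θ.2)) ≤ e * ρ * (qSymbol β θ.2).re := by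
    have := mul_nonneg (qLowerConst_pos hβ).le c2
    have : 0 ≤ e * ρ := mul_nonneg he.le (hκ.le.trans hρ)
    gcongr
  rw [realSymbol, mul_add]
  linarith

lemma tridiag_zero (n : ℕ) : tridiag n 0 = 1 := by
  ext i j
  simp [tridiag, Matrix.one_apply, Fin.ext_iff]

lemma toeplitz₂_laplacian (n₁ n₂ : ℕ) (c : ℝ) :
    toeplitz₂ n₁ n₂ (fun θ => ((c * ((1 - Real.cos θ.1) + (1 - Real.cos θ.2)) : ℝ) : ℂ)) =
      (c : ℂ) • (tridiag n₁ (-1) ⊗ₖ (1 : Matrix (Fin n₂) (Fin n₂) ℂ) +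
        (1 : Matrix (Fin n₁) (Fin n₁) ℂ) ⊗ₖ tridiag n₂ (-1)) := by
  rw [← tridiag_zero n₁, ← tridiag_zero n₂, ← toeplitz₂_one_add_cos, ← toeplitz₂_one_add_cos,
    ← toeplitz₂_add (by fun_prop) (by fun_prop), ← toeplitz₂_const_mul]
  congr 1
  ext θ
  push_cast
  ring

lemma energySq_laplacian_le {α β d e r s κ : ℝ} (hα : α ∈ Set.Ioo (1 : ℝ) 2)
    (hβ : β ∈ Set.Ioo (1 : ℝ) 2) (hd : 0 < d) (he : 0 < e) (hκ : 0 < κ) (hρ : κ ≤ s / r)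
    {n₁ n₂ : ℕ} (x : Fin n₁ × Fin n₂ → ℂ) :
    min (d * qLowerConst α) (e * κ * qLowerConst β) *
      (energySq (tridiag n₁ (-1) ⊗ₖ (1 : Matrix (Fin n₂) (Fin n₂) ℂ)) x +
        energySq ((1 : Matrix (Fin n₁) (Fin n₁) ℂ) ⊗ₖ tridiag n₂ (-1)) x) ≤
      energySq (toeplitz₂ n₁ n₂ (Fsymbol α β d e r s)) x := by
  rw [← energySq_add, ← energySq_smul, ← toeplitz₂_laplacian, Fsymbol_eq_ofReal]
  exact energySq_toeplitz₂_mono (by fun_prop)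
    (realSymbol_continuous (by linarith [hα.1]) (by linarith [hβ.1]) _ _ _)
    (fun θ hθ => laplacian_le_realSymbol hα hβ hd he hκ hρ hθ) x

lemma energySq_tridiag_nonneg {n : ℕ} (v : Fin n → ℂ) : 0 ≤ energySq (tridiag n (-1)) v := by
  have h1 := two_mul_energySq_tridiag v
  have h2 := dirichletSq_nonneg v
  linarith

lemma energySq_laplacian_pos {n₁ n₂ : ℕ} {x : Fin n₁ × Fin n₂ → ℂ} (hx : x ≠ 0) :
    0 < energySq (tridiag n₁ (-1) ⊗ₖ (1 : Matrix (Fin n₂) (Fin n₂) ℂ)) x +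
        energySq ((1 : Matrix (Fin n₁) (Fin n₁) ℂ) ⊗ₖ tridiag n₂ (-1)) x := by
  rw [energySq_kronecker_one, energySq_one_kronecker]
  refine add_pos_of_pos_of_nonneg ?_ (Finset.sum_nonneg fun _ _ => energySq_tridiag_nonneg _)
  obtain ⟨⟨i, j⟩, hij⟩ := Function.ne_iff.1 hx
  refine Finset.sum_pos' (fun _ _ => energySq_tridiag_nonneg _) ⟨j, Finset.mem_univ _, ?_⟩
  refine lt_of_le_of_ne (energySq_tridiag_nonneg _) fun h => hij ?_
  have h1 := two_mul_energySq_tridiag (fun i => x (i, j))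
  rw [← h, mul_zero] at h1
  exact congrFun (dirichletSq_eq_zero h1.symm) i

lemma posDef_toeplitz₂_Fsymbol {α β d e r s : ℝ} (hα : α ∈ Set.Ioo (1 : ℝ) 2)
    (hβ : β ∈ Set.Ioo (1 : ℝ) 2) (hd : 0 < d) (he : 0 < e) (hρ : 0 < s / r) (n₁ n₂ : ℕ) :
    (toeplitz₂ n₁ n₂ (Fsymbol α β d e r s)).PosDef := by
  have hH : (toeplitz₂ n₁ n₂ (Fsymbol α β d e r s)).IsHermitian := by
    rw [Fsymbol_eq_ofReal]
    exact toeplitz₂_isHermitian _ _ _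
  refine Matrix.PosDef.of_dotProduct_mulVec_pos hH fun x hx => ?_
  rw [Complex.pos_iff]
  refine ⟨?_, (hH.im_star_dotProduct_mulVec_self x).symm⟩
  -- A single matrix needs no uniform constant: `κ` is `s / r` itself.
  refine lt_of_lt_of_le (mul_pos ?_ (energySq_laplacian_pos hx))
    (energySq_laplacian_le hα hβ hd he hρ le_rfl x)
  exact lt_min (mul_pos hd (qLowerConst_pos hα))
    (mul_pos (mul_pos he hρ) (qLowerConst_pos hβ))

lemma exists_norm_qSymbol_le {γ : ℝ} (hγ : 0 < γ) :
    ∃ M : ℝ, 0 < M ∧ ∀ t ∈ Set.Icc (-Real.pi) Real.pi, ‖qSymbol γ t‖ ≤ M := by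
  obtain ⟨M, hM⟩ := isCompact_Icc.exists_bound_of_continuousOn
    (s := Set.Icc (-Real.pi) Real.pi) (qSymbol_continuous hγ).continuousOn
  exact ⟨max M 1, by positivity, fun t ht => (hM t ht).trans (le_max_left _ _)⟩

lemma norm_Fsymbol_le {α β d e r s K M₁ M₂ : ℝ} (hd : 0 < d) (he : 0 < e)
    (hρ : 0 < s / r) (hK : s / r ≤ K)
    (h₁ : ∀ t ∈ Set.Icc (-Real.pi) Real.pi, ‖qSymbol α t‖ ≤ M₁)
    (h₂ : ∀ t ∈ Set.Icc (-Real.pi) Real.pi, ‖qSymbol β t‖ ≤ M₂)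
    {θ : ℝ × ℝ} (hθ : θ ∈ torusBox) :
    ‖Fsymbol α β d e r s θ‖ ≤ d * M₁ + e * K * M₂ := by
  refine (norm_add_le _ _).trans ?_
  rw [norm_mul, norm_mul, norm_mul, Complex.norm_real, Complex.norm_real, Complex.norm_real,
    Real.norm_of_nonneg hd.le, Real.norm_of_nonneg he.le, Real.norm_of_nonneg hρ.le]
  have := h₁ _ hθ.1
  have := h₂ _ hθ.2
  have : 0 ≤ K := hρ.le.trans hK
  gcongr

lemma diagonal_diag_toeplitz₂ (n₁ n₂ : ℕ) (g : ℝ × ℝ → ℂ) :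
    Matrix.diagonal (toeplitz₂ n₁ n₂ g).diag = Matrix.diagonal fun _ => fourierCoeff₂ g 0 0 := by
  congr 1
  ext i
  simp [toeplitz₂]

lemma sumSq_nonneg {ι : Type*} [Fintype ι] (v : ι → ℂ) : 0 ≤ sumSq v :=
  Finset.sum_nonneg fun _ _ => by positivity

lemma fourierCoeff₂_zero_re_nonneg {g : ℝ × ℝ → ℝ} (hg : Continuous g)
    (hg0 : ∀ θ ∈ torusBox, 0 ≤ g θ) : 0 ≤ (fourierCoeff₂ (fun θ => (g θ : ℂ)) 0 0).re := by
  -- The mean of `g` is the quadratic form of the `1 × 1` Toeplitz matrix.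
  have h := energySq_toeplitz₂_nonneg hg hg0 (n₁ := 1) (n₂ := 1) (fun _ => 1)
  simpa [energySq, toeplitz₂, dotProduct, Matrix.mulVec, Fintype.sum_prod_type] using h

theorem lemma2
    (α β d e : ℝ) (hα : α ∈ Set.Ioo (1 : ℝ) 2) (hβ : β ∈ Set.Ioo (1 : ℝ) 2)
    (hd : 0 < d) (he : 0 < e)
    (n₁ n₂ : ℕ → ℕ) (hn₁ : ∀ j, Odd (n₁ j)) (hn₂ : ∀ j, Odd (n₂ j))
    (hx hy Δt : ℕ → ℝ) (hx_pos : ∀ j, 0 < hx j) (hy_pos : ∀ j, 0 < hy j)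
    (Δt_pos : ∀ j, 0 < Δt j)
    (r s : ℕ → ℝ) (hr : ∀ j, r j = meshParam (Δt j) (hx j) α)
    (hs : ∀ j, s j = meshParam (Δt j) (hy j) β)
    (hr_small : (fun j => 1 / r j) =o[atTop] (fun _ => (1 : ℝ)))
    (hsr : (fun j => s j / r j) =Θ[atTop] (fun _ => (1 : ℝ)))
    (A : (j : ℕ) → Matrix (Fin (n₁ j) × Fin (n₂ j)) (Fin (n₁ j) × Fin (n₂ j)) ℂ)
    (hA : ∀ j, A j = toeplitz₂ (n₁ j) (n₂ j) (Fsymbol α β d e (r j) (s j))) :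
    (∀ j, (A j).PosDef) ∧
    ∃ ξ : ℝ, 0 < ξ ∧ ∀ j, ∀ x : Fin (n₁ j) × Fin (n₂ j) → ℂ,
      ∃ y : Fin (coarseSize (n₁ j)) × Fin (coarseSize (n₂ j)) → ℂ,
        IsMinOn (fun z => energySq (Matrix.diagonal (A j).diag)
          (x - (projector (n₁ j) (n₂ j)).mulVec z)) Set.univ y ∧
        energySq (Matrix.diagonal (A j).diag)
          (x - (projector (n₁ j) (n₂ j)).mulVec y) ≤ ξ * energySq (A j) x := by
  have hrpos : ∀ j, 0 < r j := fun j => by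
    rw [hr, meshParam]
    have := Δt_pos j
    have := Real.rpow_pos_of_pos (hx_pos j) α
    positivity
  have hspos : ∀ j, 0 < s j := fun j => by
    rw [hs, meshParam]
    have := Δt_pos j
    have := Real.rpow_pos_of_pos (hy_pos j) β
    positivity
  have hρ : ∀ j, 0 < s j / r j := fun j => div_pos (hspos j) (hrpos j)
  refine ⟨fun j => hA j ▸ posDef_toeplitz₂_Fsymbol hα hβ hd he (hρ j) _ _, ?_⟩
  obtain ⟨κ, K, hκ, hK, hκK⟩ := exists_pos_bounds_of_isTheta_one hρ hsr
  have hα0 : 0 < α := by linarith [hα.1]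
  have hβ0 : 0 < β := by linarith [hβ.1]
  obtain ⟨M₁, hM₁, h₁⟩ := exists_norm_qSymbol_le hα0
  obtain ⟨M₂, hM₂, h₂⟩ := exists_norm_qSymbol_le hβ0
  set c := min (d * qLowerConst α) (e * κ * qLowerConst β) with hc
  have hc0 : 0 < c := lt_min (mul_pos hd (qLowerConst_pos hα))
    (mul_pos (mul_pos he hκ) (qLowerConst_pos hβ))
  set M := d * M₁ + e * K * M₂ with hM
  have hM0 : 0 < M := by positivity
  refine ⟨M * (40 / c), by positivity, fun j x => ?_⟩
  set δ := fourierCoeff₂ (Fsymbol α β d e (r j) (s j)) 0 0 with hδ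
  have hδM : δ.re ≤ M := (Complex.re_le_norm _).trans
    (norm_fourierCoeff₂_le (fun θ hθ => norm_Fsymbol_le hd he (hρ j) (hκK j).2 h₁ h₂ hθ) 0 0)
  have hδ0 : 0 ≤ δ.re := by
    rw [hδ, Fsymbol_eq_ofReal]
    refine fourierCoeff₂_zero_re_nonneg (realSymbol_continuous hα0 hβ0 _ _ _) fun θ hθ => ?_
    refine le_trans (mul_nonneg hc0.le ?_)
      (laplacian_le_realSymbol hα hβ hd he hκ (hκK j).1 hθ)
    linarith [Real.cos_le_one θ.1, Real.cos_le_one θ.2]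
  rw [hA, diagonal_diag_toeplitz₂]
  simp only [energySq_diagonal_const]
  obtain ⟨y, hy⟩ := exists_isMinOn_sumSq (projector (n₁ j) (n₂ j)) x
  refine ⟨y, fun z _ => mul_le_mul_of_nonneg_left (hy z) hδ0, ?_⟩
  -- The minimizer is compared with the coarse samples of `x`.
  have h3 := hy ((downSample (n₁ j) ⊗ₖ downSample (n₂ j)).transpose.mulVec x)
  rw [projector_mulVec_restriction (hn₁ j) (hn₂ j)] at h3
  have h4 := h3.trans (sumSq_interpolation_le x)
  have h5 := energySq_laplacian_le hα hβ hd he hκ (hκK j).1 x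
  rw [← hc, ← le_div_iff₀' hc0] at h5
  calc δ.re * sumSq (x - (projector (n₁ j) (n₂ j)).mulVec y)
      ≤ M * sumSq (x - (projector (n₁ j) (n₂ j)).mulVec y) :=
        mul_le_mul_of_nonneg_right hδM (sumSq_nonneg _)
    _ ≤ M * (40 * (energySq (toeplitz₂ (n₁ j) (n₂ j) (Fsymbol α β d e (r j) (s j))) x / c)) :=
        mul_le_mul_of_nonneg_left (h4.trans (by linarith)) hM0.le
    _ = _ := by ring
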